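/- Let $\mathcal A$ be a unital pro-$C^*$-algebra, i.e. a unital complete Hausdorff complex topological $*$-algebra whose topology is determined by the set $S(\mathcal A)$ of its continuous $C^*$-seminorms. Let $\mathcal X$ be a (left) Hilbert $\mathcal A$-module: a left $\mathcal A$-module and complex vector space, with compatible structures, together with a positive definite $\mathcal A$-valued inner product $\langle\cdot,\cdot\rangle$, $\mathbb C$- and $\mathcal A$-linear in the first variable, with $\langle\xi,\eta\rangle^*=\langle\eta,\xi\rangle$, which is complete for the topology determined by the seminorms $\bar p_{\mathcal X}(\xi)=\sqrt{p(\langle\xi,\xi\rangle)}$, $p\in S(\mathcal A)$. Let $I$ be a countable index set, and let $l^2(\mathcal X)$ be the $\mathcal A$-module of all families $(\xi_i)_{i\in I}$ in $\mathcal X$ such that $\sum_i\langle\xi_i,\xi_i\rangle$ converges in $\mathcal A$, with the inner product $\langle(\xi_i),(\eta_i)\rangle=\sum_i\langle\xi_i,\eta_i\rangle$ and the topology determined by the seminorms $\bar p_{l^2(\mathcal X)}(x)=\sqrt{p(\langle x,x\rangle)}$, $p\in S(\mathcal A)$. An adjointable operator $T$ between such modules is an $\mathcal A$-module map which has an adjoint,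 $\langle T\xi,\eta\rangle=\langle\xi,T^*\eta\rangle$, and is bounded: for every $p\in S(\mathcal A)$ there is $M_p>0$ with $\bar p(T\xi)\le M_p\,\bar p(\xi)$ for all $\xi$. Put $\bar p(T)=\sup\{\bar p(T\xi):\bar p(\xi)\le 1\}$. Let $\{T_i\}_{i\in I}$ be a family of adjointable operators on $\mathcal X$ which is a $*$-operator frame with lower bound $A$ and upper bound $B$: $A,B\in\mathcal A$ are strictly nonzero (i.e. $0$ is not in their spectrum; equivalently, they are invertible), and for all $\xi\in\mathcal X$ the series $\sum_i\langle T_i\xi,T_i\xi\rangle$ converges in $\mathcal A$ and $$A\langle\xi,\xi\rangle A^*\le\sum_{i\in I}\langle T_i\xi,T_i\xi\rangle\le B\langle\xi,\xi\rangle B^*.$$ Then the transform $R:\mathcal X\to l^2(\mathcal X)$, $R\xi=(T_i\xi)_{i\in I}$, is an injective adjointable operator with closed range, and $\bar p(R)\le p(B)$ for every $p\in S(\mathcal A)$. Its adjoint $R^*:l^2(\mathcal X)\to\mathcal X$ is surjective and is given by $R^*((\xi_i)_{i\in I})=\sum_{i\in I}T_i^*\xi_i$ for all $(\xi_i)_{i\in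 I}\in l^2(\mathcal X)$, where the series converges in $\mathcal X$. -/

import Mathlib

set_option linter.unusedSectionVars false
set_option linter.unusedSimpArgs false

section
open Filter Topology UniformSpace

/-- A `C⋆`-seminorm on a complex `⋆`-algebra: a seminorm which is submultiplicative and satisfies
the `C⋆`-identity. -/
structure IsCStarSeminorm {A : Type*} [Ring A] [StarRing A] [Algebra ℂ A] (p : Seminorm ℂ A) :
    Prop where
  mul_le : ∀ a b : A, p (a * b) ≤ p a * p b
  star_mul_self : ∀ a : A, p (star a * a) = p a ^ 2

namespace IsCStarSeminorm
section
universe u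
variable {A : Type u} [Ring A] [StarRing A] [Algebra ℂ A] {p : Seminorm ℂ A}

theorem star_le (hp : IsCStarSeminorm p) (a : A) : p a ≤ p (star a) := by
  have h := hp.mul_le (star a) a
  rw [hp.star_mul_self] at h
  rcases (apply_nonneg p a).eq_or_lt with h0 | h0
  · rw [← h0]; exact apply_nonneg p _
  · nlinarith

theorem star_eq (hp : IsCStarSeminorm p) (a : A) : p (star a) = p a :=
  le_antisymm (by simpa using hp.star_le (star a)) (hp.star_le a)

set_option maxHeartbeats 1000000 in
/-- A `C⋆`-seminorm is the pullback of the norm of a `C⋆`-algebra, namely of the completion. -/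
theorem exists_cstarAlgebra [StarModule ℂ A] (hp : IsCStarSeminorm p) :
    ∃ (B : Type u) (_ : CStarAlgebra B) (φ : A →⋆ₐ[ℂ] B), ∀ a, ‖φ a‖ = p a := by
  let _ : SeminormedRing A :=
    { (inferInstance : Ring A), p.toSeminormedAddCommGroup with
      norm_mul_le := hp.mul_le }
  have hnorm : ∀ a : A, ‖a‖ = p a := fun _ => rfl
  let _ : NormedSpace ℂ A := ⟨fun c a => (map_smul_eq_mul p c a).le⟩
  have hiso : Isometry (star : A → A) := by
    refine Isometry.of_dist_eq fun a b => ?_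
    rw [dist_eq_norm, dist_eq_norm, ← star_sub, hnorm, hnorm, hp.star_eq]
  have huc : UniformContinuous (star : A → A) := hiso.uniformContinuous
  have hcs : Continuous (Completion.map (star : A → A)) := Completion.continuous_map
  let _ : StarRing (Completion A) :=
    { star := Completion.map star
      star_involutive := fun x => by
        induction x using Completion.induction_on with
        | hp => exact isClosed_eq (hcs.comp hcs) continuous_id
        | ih a => simp [Completion.map_coe huc]
      star_mul := fun x y => by
        induction x, y using Completion.induction_on₂ with
        | hp => exact isClosed_eq (hcs.comp (by fun_prop))
                  ((hcs.comp continuous_snd).mul (hcs.comp continuous_fst))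
        | ih a b =>
          simp only [← Completion.coe_mul, Completion.map_coe huc, star_mul]
      star_add := fun x y => by
        induction x, y using Completion.induction_on₂ with
        | hp => exact isClosed_eq (hcs.comp (by fun_prop))
                  ((hcs.comp continuous_fst).add (hcs.comp continuous_snd))
        | ih a b =>
          simp only [← Completion.coe_add, Completion.map_coe huc, star_add] }
  have hstar : ∀ a : A, star (a : Completion A) = ((star a : A) : Completion A) :=
    fun a => Completion.map_coe huc a
  have hcs' : Continuous (star : Completion A → Completion A) := hcs
  let _ : Algebra ℂ (Completion A) := Algebra.ofModule
    (fun c x y => by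
      induction x, y using Completion.induction_on₂ with
      | hp => exact isClosed_eq ((continuous_fst.const_smul c).mul continuous_snd)
                ((continuous_fst.mul continuous_snd).const_smul c)
      | ih a b => simp only [← Completion.coe_mul, ← Completion.coe_smul, smul_mul_assoc])
    (fun c x y => by
      induction x, y using Completion.induction_on₂ with
      | hp => exact isClosed_eq (continuous_fst.mul (continuous_snd.const_smul c))
                ((continuous_fst.mul continuous_snd).const_smul c)
      | ih a b => simp only [← Completion.coe_mul, ← Completion.coe_smul, mul_smul_comm])
  let _ : NormedAlgebra ℂ (Completion A) := { norm_smul_le := norm_smul_le }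
  let _ : CStarAlgebra (Completion A) :=
    { norm_mul_self_le := fun x => by
        induction x using Completion.induction_on with
        | hp => exact isClosed_le (by fun_prop) (by fun_prop)
        | ih a =>
          rw [hstar, ← Completion.coe_mul, Completion.norm_coe, Completion.norm_coe, hnorm, hnorm,
            hp.star_mul_self, sq]
      star_smul := fun c x => by
        induction x using Completion.induction_on with
        | hp => exact isClosed_eq (hcs'.comp (continuous_id.const_smul c))
                  (hcs'.const_smul (star c))
        | ih a => simp only [hstar, ← Completion.coe_smul, star_smul] }
  refine ⟨Completion A, inferInstance,
    { toFun := fun a => (a : Completion A)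
      map_one' := rfl
      map_mul' := Completion.coe_mul
      map_zero' := rfl
      map_add' := Completion.coe_add
      commutes' := fun c => ?_
      map_star' := fun a => (hstar a).symm }, fun a => Completion.norm_coe a⟩
  rw [Algebra.algebraMap_eq_smul_one, Algebra.algebraMap_eq_smul_one, Completion.coe_smul]
  rfl

end
end IsCStarSeminorm

/-- The set `S(A)` of all continuous `C⋆`-seminorms on `A`. -/
def ContCStarSeminorm (A : Type*) [Ring A] [StarRing A] [Algebra ℂ A] [TopologicalSpace A] :
    Type _ :=
  {p : Seminorm ℂ A // IsCStarSeminorm p ∧ Continuous p}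

/-- A unital pro-`C⋆`-algebra: a complete Hausdorff complex topological `⋆`-algebra whose topology
is determined by its continuous `C⋆`-seminorms. -/
class ProCStarAlgebra (A : Type*) [Ring A] [StarRing A] [Algebra ℂ A] [UniformSpace A] : Prop
    extends IsUniformAddGroup A, IsTopologicalRing A, ContinuousStar A, ContinuousSMul ℂ A,
      StarModule ℂ A, CompleteSpace A, T2Space A where
  withSeminorms : WithSeminorms (fun p : ContCStarSeminorm A => p.1)

namespace ProCStarAlgebra
section
universe u
variable {A : Type u} [Ring A] [StarRing A] [Algebra ℂ A] [UniformSpace A] [ProCStarAlgebra A]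

theorem eq_zero_of_forall {a : A} (h : ∀ p : ContCStarSeminorm A, p.1 a = 0) : a = 0 := by
  by_contra ha
  obtain ⟨p, hp⟩ := (withSeminorms (A := A)).separating_of_T1 a ha
  exact hp (h p)

theorem tendsto_of_forall {ι : Type*} {l : Filter ι} {u : ι → A} {a : A}
    (h : ∀ p : ContCStarSeminorm A, Tendsto (fun i => p.1 (u i - a)) l (𝓝 0)) :
    Tendsto u l (𝓝 a) := by
  rw [(withSeminorms (A := A)).tendsto_nhds]
  intro p ε hε
  exact (h p).eventually (gt_mem_nhds hε)

theorem cauchy_map_of_forall {ι : Type*} {l : Filter ι} [NeBot l] {u : ι → A}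
    (h : ∀ p : ContCStarSeminorm A,
      Tendsto (fun i : ι × ι => p.1 (u i.2 - u i.1)) (l ×ˢ l) (𝓝 0)) : Cauchy (map u l) := by
  have h2 : Tendsto (fun i : ι × ι => u i.2 - u i.1) (l ×ˢ l) (𝓝 0) :=
    tendsto_of_forall (by simpa using h)
  refine ⟨inferInstance, ?_⟩
  rw [uniformity_eq_comap_nhds_zero A, Filter.prod_map_map_eq]
  exact map_le_iff_le_comap.2 (by rw [Filter.comap_comap]; exact h2.le_comap)

variable [PartialOrder A] [StarOrderedRing A]

theorem mono (p : ContCStarSeminorm A) {a b : A} (ha : 0 ≤ a) (hab : a ≤ b) : p.1 a ≤ p.1 b := by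
  obtain ⟨B, _, φ, hφ⟩ := p.2.1.exists_cstarAlgebra
  let _ := CStarAlgebra.spectralOrder B
  have _ := CStarAlgebra.spectralOrderedRing B
  rw [← hφ, ← hφ]
  exact CStarAlgebra.norm_le_norm_of_nonneg_of_le (map_nonneg φ ha)
    (OrderHomClass.mono φ hab)

/-- An element which is positive in every `C⋆`-quotient is positive. -/
theorem nonneg_of_forall {a : A}
    (h : ∀ p : ContCStarSeminorm A, ∃ (B : Type u) (_ : CStarAlgebra B) (_ : PartialOrder B)
      (_ : StarOrderedRing B) (φ : A →⋆ₐ[ℂ] B), (∀ x, ‖φ x‖ = p.1 x) ∧ 0 ≤ φ a) : 0 ≤ a := by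
  have hpol : ∀ n : ℕ, ∃ q : Polynomial ℝ, ∀ x ∈ Set.Icc (0 : ℝ) n,
      |q.eval x - √x| < 1 / (n + 1) := fun n =>
    exists_polynomial_near_of_continuousOn 0 n Real.sqrt Real.continuous_sqrt.continuousOn _
      (by positivity)
  choose q hq using hpol
  have hsa : star a = a := by
    rw [← sub_eq_zero]
    refine eq_zero_of_forall fun p => ?_
    obtain ⟨B, _, _, _, φ, hφ, ha⟩ := h p
    rw [← hφ, map_sub, map_star, ha.isSelfAdjoint.star_eq, sub_self, norm_zero]
  have key : ∀ (B : Type u) (_ : CStarAlgebra B) (_ : PartialOrder B)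
      (_ : StarOrderedRing B) (φ : A →⋆ₐ[ℂ] B), 0 ≤ φ a →
      ∃ r : B, star r * r = φ a ∧
        Tendsto (fun n => φ (Polynomial.aeval a (q n))) atTop (𝓝 r) := by
    intro B _ _ _ φ ha
    have hs : IsSelfAdjoint (φ a) := ha.isSelfAdjoint
    have hspec : ∀ x ∈ spectrum ℝ (φ a), 0 ≤ x := fun x hx => spectrum_nonneg_of_nonneg ha hx
    refine ⟨cfc Real.sqrt (φ a), ?_, ?_⟩
    · rw [(cfc_predicate Real.sqrt (φ a) : IsSelfAdjoint _).star_eq, ← cfc_mul ..]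
      conv_rhs => rw [← cfc_id ℝ (φ a)]
      exact cfc_congr fun x hx => by simp [Real.mul_self_sqrt (hspec x hx)]
    · have hmap : ∀ n, φ (Polynomial.aeval a (q n)) = cfc (fun x => (q n).eval x) (φ a) := by
        intro n
        rw [cfc_polynomial ..]
        exact (Polynomial.aeval_algHom_apply (φ.toAlgHom.restrictScalars ℝ) a (q n)).symm
      rw [tendsto_iff_norm_sub_tendsto_zero]
      refine squeeze_zero' (Eventually.of_forall fun _ => norm_nonneg _) ?_
        tendsto_one_div_add_atTop_nhds_zero_nat
      obtain ⟨N, hN⟩ := exists_nat_ge (‖φ a‖ * ‖(1 : B)‖)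
      filter_upwards [eventually_ge_atTop N] with n hn
      rw [hmap, ← cfc_sub ..]
      refine norm_cfc_le (by positivity) fun x hx => ?_
      refine (hq n x ⟨hspec x hx, ?_⟩).le
      calc x ≤ ‖x‖ := le_abs_self x
        _ ≤ ‖φ a‖ * ‖(1 : B)‖ := spectrum.norm_le_norm_mul_of_mem hx
        _ ≤ N := hN
        _ ≤ n := by exact_mod_cast hn
  have hC : Cauchy (map (fun n => Polynomial.aeval a (q n)) atTop) := by
    refine cauchy_map_of_forall fun p => ?_
    obtain ⟨B, _, _, _, φ, hφ, ha⟩ := h p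
    obtain ⟨r, -, hr⟩ := key B _ _ inferInstance φ ha
    have := ((hr.comp tendsto_snd).sub (hr.comp (tendsto_fst (f := atTop) (g := atTop)))).norm
    rw [sub_self, norm_zero] at this
    refine this.congr fun i => ?_
    rw [← hφ, map_sub]
    rfl
  obtain ⟨s, hs⟩ := CompleteSpace.complete hC
  have hsa : star s * s = a := by
    rw [← sub_eq_zero]
    refine eq_zero_of_forall fun p => ?_
    obtain ⟨B, _, _, _, φ, hφ, ha⟩ := h p
    obtain ⟨r, hr, hr'⟩ := key B _ _ inferInstance φ ha
    have hφs : φ s = r := by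
      refine tendsto_nhds_unique ?_ hr'
      rw [tendsto_iff_norm_sub_tendsto_zero]
      simp only [← map_sub, hφ]
      have h1 : Tendsto (fun n => Polynomial.aeval a (q n) - s) atTop (𝓝 0) := by
        simpa using (show Tendsto _ _ _ from hs).sub_const s
      have h2 := (p.2.2.tendsto 0).comp h1
      rw [map_zero] at h2
      exact h2
    rw [← hφ, map_sub, map_mul, map_star, hφs, hr, sub_self, norm_zero]
  rw [← hsa]
  exact star_mul_self_nonneg s

instance orderClosedTopology : OrderClosedTopology A := by
  have _ : IsOrderedAddMonoid A := inferInstance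
  have hcl : IsClosed {a : A | 0 ≤ a} := by
    refine isClosed_of_closure_subset fun a ha => ?_
    refine nonneg_of_forall fun p => ?_
    obtain ⟨B, _, φ, hφ⟩ := p.2.1.exists_cstarAlgebra
    let _ := CStarAlgebra.spectralOrder B
    have _ := CStarAlgebra.spectralOrderedRing B
    refine ⟨B, inferInstance, inferInstance, inferInstance, φ, hφ, ?_⟩
    have hcont : Continuous φ := by
      refine continuous_of_tendsto_nhds_zero φ ?_
      rw [tendsto_zero_iff_norm_tendsto_zero]
      simp only [hφ]
      simpa using p.2.2.tendsto 0
    have hcl' : IsClosed {a : A | 0 ≤ φ a} := isClosed_le continuous_const hcont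
    exact closure_minimal (fun x hx => map_nonneg φ hx) hcl' ha
  refine ⟨?_⟩
  have : {x : A × A | x.1 ≤ x.2} = (fun x : A × A => x.2 - x.1) ⁻¹' {a : A | 0 ≤ a} := by
    ext x; simp
  rw [this]
  exact hcl.preimage (by fun_prop)

theorem summable_of_le {I : Type*} {f g : I → A} (hf : ∀ i, 0 ≤ f i) (hfg : ∀ i, f i ≤ g i)
    (hg : Summable g) : Summable f := by
  rw [summable_iff_vanishing] at hg ⊢
  intro e he
  obtain ⟨⟨s, r⟩, hr, hsub⟩ := (withSeminorms (A := A)).hasBasis_zero_ball.mem_iff.1 he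
  obtain ⟨t, ht⟩ := hg _ ((withSeminorms (A := A)).hasBasis_zero_ball.mem_of_mem
    (i := (s, r)) hr)
  refine ⟨t, fun t' hd => hsub ?_⟩
  have := ht t' hd
  simp only [Seminorm.mem_ball_zero] at this ⊢
  refine lt_of_le_of_lt ?_ this
  refine Seminorm.finset_sup_apply_le (apply_nonneg _ _) fun p hp => ?_
  exact (mono p (Finset.sum_nonneg fun i _ => hf i) (Finset.sum_le_sum fun i _ => hfg i)).trans
    (Seminorm.le_finset_sup_apply hp)

end
end ProCStarAlgebra

/-- A pre-Hilbert module over `𝒜`: a complex vector space which is a compatible left `𝒜`-module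
(compatibility is the instance `IsScalarTower ℂ 𝒜 X`), with a definite positive `𝒜`-valued inner
product `inner 𝒜 ξ η`, which is `ℂ`- and `𝒜`-linear in its *first* variable. -/
class PreHilbertModule (𝒜 X : Type*) [Ring 𝒜] [StarRing 𝒜] [Algebra ℂ 𝒜] [PartialOrder 𝒜]
    [AddCommGroup X] [Module ℂ X] [Module 𝒜 X] [IsScalarTower ℂ 𝒜 X] extends Inner 𝒜 X where
  inner_add_left : ∀ ξ η ζ : X, inner (ξ + η) ζ = inner ξ ζ + inner η ζ
  inner_smul_left : ∀ (a : 𝒜) (ξ η : X), inner (a • ξ) η = a * inner ξ η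
  inner_smul_left_complex : ∀ (c : ℂ) (ξ η : X), inner (c • ξ) η = c • inner ξ η
  star_inner : ∀ ξ η : X, star (inner ξ η) = inner η ξ
  inner_self_nonneg : ∀ ξ : X, 0 ≤ inner ξ ξ
  inner_self : ∀ ξ : X, inner ξ ξ = 0 ↔ ξ = 0

namespace PreHilbertModule
section
universe u
variable {𝒜 : Type u} {X : Type*} [Ring 𝒜] [StarRing 𝒜] [Algebra ℂ 𝒜] [UniformSpace 𝒜]
  [PartialOrder 𝒜] [StarOrderedRing 𝒜] [ProCStarAlgebra 𝒜]
  [AddCommGroup X] [Module ℂ X] [Module 𝒜 X] [IsScalarTower ℂ 𝒜 X] [PreHilbertModule 𝒜 X]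

theorem inner_add_right (ξ η ζ : X) : inner 𝒜 ξ (η + ζ) = inner 𝒜 ξ η + inner 𝒜 ξ ζ := by
  rw [← star_inner, inner_add_left, star_add, star_inner, star_inner]

theorem inner_smul_right (a : 𝒜) (ξ η : X) : inner 𝒜 ξ (a • η) = inner 𝒜 ξ η * star a := by
  rw [← star_inner, inner_smul_left, star_mul, star_inner]

theorem inner_smul_right_complex (c : ℂ) (ξ η : X) :
    inner 𝒜 ξ (c • η) = star c • inner 𝒜 ξ η := by
  rw [← star_inner, inner_smul_left_complex, star_smul, star_inner]

theorem inner_sub_left (ξ η ζ : X) : inner 𝒜 (ξ - η) ζ = inner 𝒜 ξ ζ - inner 𝒜 η ζ := by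
  rw [eq_sub_iff_add_eq, ← inner_add_left, sub_add_cancel]

theorem inner_sub_right (ξ η ζ : X) : inner 𝒜 ξ (η - ζ) = inner 𝒜 ξ η - inner 𝒜 ξ ζ := by
  rw [eq_sub_iff_add_eq, ← inner_add_right, sub_add_cancel]

/-- Two vectors with the same inner products are equal. -/
theorem ext_inner {ξ η : X} (h : ∀ ζ : X, inner 𝒜 ζ ξ = inner 𝒜 ζ η) : ξ = η := by
  rw [← sub_eq_zero, ← inner_self (𝒜 := 𝒜), inner_sub_right, h, sub_self]

/-- The Cauchy-Schwarz inequality. -/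
theorem sq_apply_inner_le (p : ContCStarSeminorm 𝒜) (ξ η : X) :
    p.1 (inner 𝒜 ξ η) ^ 2 ≤ p.1 (inner 𝒜 ξ ξ) * p.1 (inner 𝒜 η η) := by
  obtain ⟨B, _, φ, hφ⟩ := p.2.1.exists_cstarAlgebra
  let _ := CStarAlgebra.spectralOrder B
  have _ := CStarAlgebra.spectralOrderedRing B
  set z := φ (inner 𝒜 ξ η) with hz
  have hz' : φ (inner 𝒜 η ξ) = star z := by rw [hz, ← map_star, star_inner]
  have key : ∀ t : ℝ, 0 < t → p.1 (inner 𝒜 η η) ≤ t →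
      p.1 (inner 𝒜 ξ η) ^ 2 ≤ p.1 (inner 𝒜 ξ ξ) * t := by
    intro t ht hpt
    have h1 : (0 : B) ≤ φ (inner 𝒜 ((t : ℂ) • ξ - inner 𝒜 ξ η • η)
        ((t : ℂ) • ξ - inner 𝒜 ξ η • η)) := map_nonneg φ (inner_self_nonneg _)
    have h2 : φ (inner 𝒜 ((t : ℂ) • ξ - inner 𝒜 ξ η • η) ((t : ℂ) • ξ - inner 𝒜 ξ η • η)) =
        (t ^ 2) • φ (inner 𝒜 ξ ξ) - (2 * t) • (z * star z)
          + z * φ (inner 𝒜 η η) * star z := by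
      have hstar : star (t : ℂ) = t := Complex.conj_ofReal t
      simp only [inner_sub_left, inner_sub_right, inner_smul_left, inner_smul_right,
        inner_smul_left_complex, inner_smul_right_complex, hstar]
      simp only [map_sub, map_mul, map_smul, map_star, ← hz, hz']
      simp only [Complex.coe_smul, mul_smul_comm, smul_mul_assoc, ← mul_assoc, sub_mul, smul_sub]
      module
    have h3 : z * φ (inner 𝒜 η η) * star z ≤ t • (z * star z) := by
      have h4 : φ (inner 𝒜 η η) ≤ algebraMap ℝ B t :=
        ((map_nonneg φ (inner_self_nonneg η)).isSelfAdjoint.le_algebraMap_norm_self).trans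
          (by rw [hφ]; exact algebraMap_mono B hpt)
      have h5 := star_right_conjugate_le_conjugate h4 z
      rwa [Algebra.algebraMap_eq_smul_one, mul_smul_comm, mul_one, smul_mul_assoc] at h5
    have h6 : t • (z * star z) ≤ (t ^ 2) • φ (inner 𝒜 ξ ξ) := by
      rw [h2] at h1
      have h7 : 0 ≤ (t ^ 2) • φ (inner 𝒜 ξ ξ) - (2 * t) • (z * star z) + t • (z * star z) :=
        h1.trans (by gcongr)
      rw [← sub_nonneg]
      refine h7.trans_eq ?_
      module
    have h8 := CStarAlgebra.norm_le_norm_of_nonneg_of_le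
      (smul_nonneg ht.le (mul_star_self_nonneg z)) h6
    rw [norm_smul, norm_smul, CStarRing.norm_self_mul_star, hz, hφ, hφ, Real.norm_of_nonneg ht.le,
      Real.norm_of_nonneg (by positivity)] at h8
    nlinarith
  have hlim : Tendsto (fun t : ℝ => p.1 (inner 𝒜 ξ ξ) * t) (𝓝[>] p.1 (inner 𝒜 η η))
      (𝓝 (p.1 (inner 𝒜 ξ ξ) * p.1 (inner 𝒜 η η))) :=
    ((continuous_const.mul continuous_id).tendsto _).mono_left nhdsWithin_le_nhds
  refine ge_of_tendsto hlim ?_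
  filter_upwards [self_mem_nhdsWithin] with t ht
  exact key t ((apply_nonneg p.1 _).trans_lt ht) (le_of_lt ht)

variable (X) in
/-- The seminorm `p̄_X(ξ) = √p(⟨ξ, ξ⟩)` on a pre-Hilbert module. -/
noncomputable def bar (p : ContCStarSeminorm 𝒜) : Seminorm ℂ X :=
  Seminorm.of (fun ξ : X => √(p.1 (inner 𝒜 ξ ξ)))
    (fun ξ η => by
      have hcs : p.1 (inner 𝒜 ξ η) ≤ √(p.1 (inner 𝒜 ξ ξ)) * √(p.1 (inner 𝒜 η η)) := by
        rw [← Real.sqrt_mul (apply_nonneg _ _)]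
        exact Real.le_sqrt_of_sq_le (sq_apply_inner_le p ξ η)
      have hcs' : p.1 (inner 𝒜 η ξ) ≤ √(p.1 (inner 𝒜 ξ ξ)) * √(p.1 (inner 𝒜 η η)) := by
        rwa [← star_inner, p.2.1.star_eq]
      refine Real.sqrt_le_iff.2 ⟨by positivity, ?_⟩
      rw [inner_add_left, inner_add_right, inner_add_right]
      have h1 := map_add_le_add p.1 (inner 𝒜 ξ ξ + inner 𝒜 ξ η) (inner 𝒜 η ξ + inner 𝒜 η η)
      have h2 := map_add_le_add p.1 (inner 𝒜 ξ ξ) (inner 𝒜 ξ η)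
      have h3 := map_add_le_add p.1 (inner 𝒜 η ξ) (inner 𝒜 η η)
      have h4 := Real.sq_sqrt (apply_nonneg p.1 (inner 𝒜 ξ ξ))
      have h5 := Real.sq_sqrt (apply_nonneg p.1 (inner 𝒜 η η))
      nlinarith)
    (fun c ξ => by
      rw [inner_smul_left_complex, inner_smul_right_complex, smul_smul, map_smul_eq_mul,
        Real.sqrt_mul (norm_nonneg _), norm_mul, norm_star, Real.sqrt_mul_self (norm_nonneg _)])

theorem bar_apply (p : ContCStarSeminorm 𝒜) (ξ : X) : bar X p ξ = √(p.1 (inner 𝒜 ξ ξ)) := rfl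

theorem bar_sq (p : ContCStarSeminorm 𝒜) (ξ : X) : bar X p ξ ^ 2 = p.1 (inner 𝒜 ξ ξ) :=
  Real.sq_sqrt (apply_nonneg _ _)

theorem apply_inner_le (p : ContCStarSeminorm 𝒜) (ξ η : X) :
    p.1 (inner 𝒜 ξ η) ≤ bar X p ξ * bar X p η := by
  rw [bar_apply, bar_apply, ← Real.sqrt_mul (apply_nonneg _ _)]
  exact Real.le_sqrt_of_sq_le (sq_apply_inner_le p ξ η)

end
end PreHilbertModule


/-- A Hilbert `𝒜`-module: a pre-Hilbert module which is complete for the topology determined by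
the seminorms `p̄_X`, where `p` runs over the continuous `C⋆`-seminorms of `𝒜`. -/
class HilbertModule (𝒜 X : Type*) [Ring 𝒜] [StarRing 𝒜] [Algebra ℂ 𝒜] [UniformSpace 𝒜]
    [PartialOrder 𝒜] [StarOrderedRing 𝒜] [ProCStarAlgebra 𝒜]
    [AddCommGroup X] [Module ℂ X] [Module 𝒜 X] [IsScalarTower ℂ 𝒜 X] [PreHilbertModule 𝒜 X]
    [UniformSpace X] : Prop extends IsUniformAddGroup X, CompleteSpace X where
  withSeminorms : WithSeminorms (fun p : ContCStarSeminorm 𝒜 => PreHilbertModule.bar X p)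

section Operators
variable (𝒜 X Y : Type*) [Ring 𝒜] [StarRing 𝒜] [Algebra ℂ 𝒜] [UniformSpace 𝒜]
  [PartialOrder 𝒜] [StarOrderedRing 𝒜] [ProCStarAlgebra 𝒜]
  [AddCommGroup X] [Module ℂ X] [Module 𝒜 X] [IsScalarTower ℂ 𝒜 X] [PreHilbertModule 𝒜 X]
  [AddCommGroup Y] [Module ℂ Y] [Module 𝒜 Y] [IsScalarTower ℂ 𝒜 Y] [PreHilbertModule 𝒜 Y]

/-- `Hom⋆_𝒜(X, Y)`: the adjointable operators, that is, the `𝒜`-module maps `X → Y` which have an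
adjoint and are bounded with respect to each of the seminorms. -/
structure AdjointableOperator extends X →ₗ[𝒜] Y where
  exists_adjoint : ∃ S : Y → X, ∀ ξ η, inner 𝒜 (toFun ξ) η = inner 𝒜 ξ (S η)
  bounded : ∀ p : ContCStarSeminorm 𝒜, ∃ M : ℝ, 0 < M ∧ ∀ ξ, PreHilbertModule.bar Y p (toFun ξ) ≤ M * PreHilbertModule.bar X p ξ

namespace AdjointableOperator
variable {𝒜 X Y}

instance : CoeFun (AdjointableOperator 𝒜 X Y) (fun _ => X → Y) := ⟨fun T => T.toLinearMap⟩

/-- The adjoint operator. -/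
noncomputable def adjoint (T : AdjointableOperator 𝒜 X Y) : AdjointableOperator 𝒜 Y X where
  toFun := T.exists_adjoint.choose
  map_add' η ζ := by
    have h := T.exists_adjoint.choose_spec
    refine PreHilbertModule.ext_inner (𝒜 := 𝒜) fun ξ => ?_
    rw [PreHilbertModule.inner_add_right, ← h, ← h, ← h, PreHilbertModule.inner_add_right]
  map_smul' a η := by
    have h := T.exists_adjoint.choose_spec
    refine PreHilbertModule.ext_inner (𝒜 := 𝒜) fun ξ => ?_
    rw [RingHom.id_apply, PreHilbertModule.inner_smul_right, ← h, ← h, PreHilbertModule.inner_smul_right]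
  exists_adjoint := ⟨T, fun η ξ => by
    have h := T.exists_adjoint.choose_spec
    rw [← PreHilbertModule.star_inner, ← h, PreHilbertModule.star_inner]
    rfl⟩
  bounded p := by
    obtain ⟨M, hM, hT⟩ := T.bounded p
    have h := T.exists_adjoint.choose_spec
    refine ⟨M, hM, fun η => ?_⟩
    set ζ := T.exists_adjoint.choose η
    have h1 : PreHilbertModule.bar X p ζ ^ 2 ≤ M * PreHilbertModule.bar X p ζ * PreHilbertModule.bar Y p η := by
      rw [PreHilbertModule.bar_sq, ← h]
      exact (PreHilbertModule.apply_inner_le p _ _).trans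
        (mul_le_mul_of_nonneg_right (hT ζ) (apply_nonneg _ _))
    rcases (apply_nonneg (PreHilbertModule.bar X p) ζ).eq_or_lt with h0 | h0
    · rw [← h0]; exact mul_nonneg hM.le (apply_nonneg _ _)
    · nlinarith

theorem inner_adjoint_right (T : AdjointableOperator 𝒜 X Y) (ξ : X) (η : Y) :
    inner 𝒜 (T ξ) η = inner 𝒜 ξ (T.adjoint η) :=
  T.exists_adjoint.choose_spec ξ η

/-- The seminorm `p̄(T) = sup {p̄_Y(T ξ) : p̄_X(ξ) ≤ 1}` of an operator. The supremum is over a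
non-empty set which is bounded above, as `T` is bounded. -/
noncomputable def seminorm (p : ContCStarSeminorm 𝒜) (T : AdjointableOperator 𝒜 X Y) : ℝ :=
  sSup ((fun ξ => PreHilbertModule.bar Y p (T ξ)) '' {ξ | PreHilbertModule.bar X p ξ ≤ 1})

end AdjointableOperator
end Operators

section L2
variable (𝒜 I X : Type*) [Ring 𝒜] [StarRing 𝒜] [Algebra ℂ 𝒜] [UniformSpace 𝒜]
  [PartialOrder 𝒜] [StarOrderedRing 𝒜] [ProCStarAlgebra 𝒜]
  [AddCommGroup X] [Module ℂ X] [Module 𝒜 X] [IsScalarTower ℂ 𝒜 X] [PreHilbertModule 𝒜 X]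

/-- The families `(ξ_i)` in `X` for which `∑ ⟨ξ_i, ξ_i⟩` converges in `𝒜`. -/
def l2Submodule : Submodule 𝒜 (I → X) where
  carrier := {x | Summable fun i => inner 𝒜 (x i) (x i)}
  zero_mem' := by
    have : ∀ i : I, inner 𝒜 ((0 : I → X) i) ((0 : I → X) i) = 0 := fun i => (PreHilbertModule.inner_self _).2 rfl
    simp only [Set.mem_ofPred_eq, this]
    exact summable_zero
  add_mem' {x y} hx hy := by
    have h2 : Summable fun i => (inner 𝒜 (x i) (x i) + inner 𝒜 (x i) (x i))
        + (inner 𝒜 (y i) (y i) + inner 𝒜 (y i) (y i)) := (hx.add hx).add (hy.add hy)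
    refine ProCStarAlgebra.summable_of_le (fun i => PreHilbertModule.inner_self_nonneg _) (fun i => ?_) h2
    rw [← sub_nonneg]
    refine (PreHilbertModule.inner_self_nonneg (𝒜 := 𝒜) (x i - y i)).trans_eq ?_
    simp only [Pi.add_apply, PreHilbertModule.inner_sub_left, PreHilbertModule.inner_sub_right, PreHilbertModule.inner_add_left, PreHilbertModule.inner_add_right]
    abel
  smul_mem' a x hx := by
    have : ∀ i, inner 𝒜 ((a • x) i) ((a • x) i) = a * inner 𝒜 (x i) (x i) * star a := fun i => by
      rw [Pi.smul_apply, PreHilbertModule.inner_smul_left, PreHilbertModule.inner_smul_right, mul_assoc]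
    simp only [Set.mem_ofPred_eq, this]
    exact (hx.mul_left a).mul_right (star a)

/-- The standard Hilbert module `l²(X)` over the index set `I`: the families `(ξ_i)` in `X` for
which `∑ ⟨ξ_i, ξ_i⟩` converges in `𝒜`. It is a type synonym of `l2Submodule` because its topology
is not the topology of pointwise convergence. -/
def L2 : Type _ := l2Submodule 𝒜 I X

namespace L2
variable {𝒜 I X}

instance : AddCommGroup (L2 𝒜 I X) := inferInstanceAs (AddCommGroup (l2Submodule 𝒜 I X))
instance : Module 𝒜 (L2 𝒜 I X) := inferInstanceAs (Module 𝒜 (l2Submodule 𝒜 I X))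
instance : Module ℂ (L2 𝒜 I X) := inferInstanceAs (Module ℂ (l2Submodule 𝒜 I X))
instance : IsScalarTower ℂ 𝒜 (L2 𝒜 I X) :=
  inferInstanceAs (IsScalarTower ℂ 𝒜 (l2Submodule 𝒜 I X))
instance : CoeFun (L2 𝒜 I X) (fun _ => I → X) := ⟨fun x => x.1⟩

theorem add_apply (x y : L2 𝒜 I X) (i : I) : (x + y) i = x i + y i := rfl
theorem smul_apply (a : 𝒜) (x : L2 𝒜 I X) (i : I) : (a • x) i = a • x i := rfl
theorem smul_complex_apply (c : ℂ) (x : L2 𝒜 I X) (i : I) : (c • x) i = c • x i := rfl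

theorem summable_inner_self (x : L2 𝒜 I X) : Summable fun i => inner 𝒜 (x i) (x i) := x.2

/-- The series which defines the inner product of `l²(X)` converges. -/
theorem summable_inner (x y : L2 𝒜 I X) : Summable fun i => inner 𝒜 (x i) (y i) := by
  have h := fun c : ℂ => (summable_inner_self (x + c • y)).sub (summable_inner_self (x - c • y))
  have h2 := ((h 1).add ((h Complex.I).const_smul Complex.I)).const_smul (4⁻¹ : ℂ)
  refine h2.congr fun i => ?_
  have e : ∀ c : ℂ, inner 𝒜 ((x + c • y) i) ((x + c • y) i) - inner 𝒜 ((x - c • y) i) ((x - c • y) i)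
      = (2 : ℂ) • (star c • inner 𝒜 (x i) (y i) + c • inner 𝒜 (y i) (x i)) := fun c => by
    rw [show (x + c • y) i = x i + c • y i from rfl, show (x - c • y) i = x i - c • y i from rfl]
    simp only [PreHilbertModule.inner_sub_left, PreHilbertModule.inner_sub_right,
      PreHilbertModule.inner_add_left, PreHilbertModule.inner_add_right,
      PreHilbertModule.inner_smul_left_complex, PreHilbertModule.inner_smul_right_complex]
    module
  rw [e, e]
  have hI : star Complex.I = -Complex.I := Complex.conj_I
  have h1 : (Complex.I * Complex.I : ℂ) = -1 := Complex.I_mul_I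
  simp only [star_one, hI, smul_add, smul_smul]
  match_scalars
  · linear_combination (-(1 / 2 : ℂ)) * h1
  · linear_combination (1 / 2 : ℂ) * h1

/-- `l²(X)` is a pre-Hilbert module for the inner product `∑ ⟨ξ_i, η_i⟩`. -/
noncomputable instance : PreHilbertModule 𝒜 (L2 𝒜 I X) where
  inner x y := ∑' i, inner 𝒜 (x i) (y i)
  inner_add_left x y z := by
    rw [← (summable_inner x z).tsum_add (summable_inner y z)]
    exact tsum_congr fun i => PreHilbertModule.inner_add_left _ _ _
  inner_smul_left a x y := by
    rw [← (summable_inner x y).tsum_mul_left]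
    exact tsum_congr fun i => PreHilbertModule.inner_smul_left _ _ _
  inner_smul_left_complex c x y := by
    rw [← (summable_inner x y).tsum_const_smul]
    exact tsum_congr fun i => PreHilbertModule.inner_smul_left_complex _ _ _
  star_inner x y := by
    rw [tsum_star]
    exact tsum_congr fun i => PreHilbertModule.star_inner _ _
  inner_self_nonneg x := tsum_nonneg fun i => PreHilbertModule.inner_self_nonneg _
  inner_self x := by
    constructor
    · intro h
      have h1 := (hasSum_zero_iff_of_nonneg (fun i => PreHilbertModule.inner_self_nonneg (x i))).1
        (h ▸ (summable_inner_self x).hasSum)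
      refine Subtype.ext (funext fun i => (PreHilbertModule.inner_self (𝒜 := 𝒜) (x i)).1 (congrFun h1 i))
    · rintro rfl
      exact (tsum_congr fun i => (PreHilbertModule.inner_self _).2 rfl).trans tsum_zero

theorem inner_def (x y : L2 𝒜 I X) : inner 𝒜 x y = ∑' i, inner 𝒜 (x i) (y i) := rfl

/-- The uniform structure of `l²(X)` is the one determined by the seminorms `p̄`. -/
noncomputable instance : UniformSpace (L2 𝒜 I X) :=
  ⨅ p : ContCStarSeminorm 𝒜, (PreHilbertModule.bar (L2 𝒜 I X) p).toSeminormedAddCommGroup.toUniformSpace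

instance : IsUniformAddGroup (L2 𝒜 I X) :=
  isUniformAddGroup_iInf fun p =>
    (PreHilbertModule.bar (L2 𝒜 I X) p).toSeminormedAddCommGroup.to_isUniformAddGroup

theorem withSeminorms : WithSeminorms (fun p : ContCStarSeminorm 𝒜 => PreHilbertModule.bar (L2 𝒜 I X) p) :=
  (SeminormFamily.withSeminorms_iff_uniformSpace_eq_iInf _).2 rfl

end L2
end L2

section Frames
variable {𝒜 I X : Type*} [Ring 𝒜] [StarRing 𝒜] [Algebra ℂ 𝒜] [UniformSpace 𝒜]
  [PartialOrder 𝒜] [StarOrderedRing 𝒜] [ProCStarAlgebra 𝒜]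
  [AddCommGroup X] [Module ℂ X] [Module 𝒜 X] [IsScalarTower ℂ 𝒜 X] [PreHilbertModule 𝒜 X]

/-- An element is strictly nonzero if `0` is not in its spectrum, that is, if it is invertible. -/
def StrictlyNonzero (a : 𝒜) : Prop := (0 : ℂ) ∉ spectrum ℂ a

/-- `(T_i)` is a `⋆`-operator frame with lower bound `A` and upper bound `B`: these are strictly
nonzero and `A ⟨ξ, ξ⟩ A⋆ ≤ ∑ ⟨T_i ξ, T_i ξ⟩ ≤ B ⟨ξ, ξ⟩ B⋆` for all `ξ`, where the series
converges in `𝒜`. -/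
structure IsStarOperatorFrame (T : I → AdjointableOperator 𝒜 X X) (A B : 𝒜) : Prop where
  lower_ne : StrictlyNonzero A
  upper_ne : StrictlyNonzero B
  summable : ∀ ξ, Summable fun i => inner 𝒜 (T i ξ) (T i ξ)
  lower : ∀ ξ, A * inner 𝒜 ξ ξ * star A ≤ ∑' i, inner 𝒜 (T i ξ) (T i ξ)
  upper : ∀ ξ, ∑' i, inner 𝒜 (T i ξ) (T i ξ) ≤ B * inner 𝒜 ξ ξ * star B

end Frames

end

/-! Everything is done one seminorm `p` at a time. Applying `p` to the two frame inequalities, and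
inverting `A` in the lower one, gives `p̄(Rξ) ≤ p(B) p̄(ξ)` and `p̄(ξ) ≤ p(A⁻¹) p̄(Rξ)`. Hence `R`
is injective and induces the topology of `X`, so its range inherits completeness from `X` and is
closed (`isClosed_range_of_bounded_below`).

For the adjoint, a finite sum `ζ = ∑ T_i⋆ x_i` satisfies `⟨ζ, ζ⟩ = ⟨Rζ, y⟩` with `y` the truncation
of `x`. Cauchy-Schwarz bounds `p̄(ζ)` by `p(B) p̄(y)` (`bar_sum_adjoint_le`), so the series is
Cauchy and its sum is the value of the adjoint.

Surjectivity of `R⋆` follows from that of `S = R⋆R`, which is positive, bounded and bounded below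
for each `p`. Its range is closed, so density suffices. Since the seminorms are directed, it is
enough to approximate for a single `p`, where the constants are fixed and the method of continuity
along `S + t` applies (`exists_bar_sub_lt`). -/

open Filter Topology UniformSpace

/-! ### Directedness of the continuous C⋆-seminorms. -/

namespace ContCStarSeminorm
variable {A : Type*} [Ring A] [StarRing A] [Algebra ℂ A] [UniformSpace A] [ProCStarAlgebra A]

/-- The pointwise maximum works: squaring is monotone on nonnegative reals, so the C⋆-identity
survives taking maxima. -/
theorem exists_ge_pair (p q : ContCStarSeminorm A) :
    ∃ r : ContCStarSeminorm A, p.1 ≤ r.1 ∧ q.1 ≤ r.1 := by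
  refine ⟨⟨p.1 ⊔ q.1, ⟨fun a b => ?_, fun a => ?_⟩, ?_⟩, le_sup_left, le_sup_right⟩
  · simp only [Seminorm.sup_apply]
    refine max_le ((p.2.1.mul_le a b).trans ?_) ((q.2.1.mul_le a b).trans ?_)
    · exact mul_le_mul (le_max_left _ _) (le_max_left _ _) (apply_nonneg _ _)
        ((apply_nonneg _ _).trans (le_max_left _ _))
    · exact mul_le_mul (le_max_right _ _) (le_max_right _ _) (apply_nonneg _ _)
        ((apply_nonneg _ _).trans (le_max_left _ _))
  · simp only [Seminorm.sup_apply, p.2.1.star_mul_self, q.2.1.star_mul_self]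
    rcases le_total (p.1 a) (q.1 a) with h | h
    · rw [max_eq_right h, max_eq_right (pow_le_pow_left₀ (apply_nonneg _ _) h 2)]
    · rw [max_eq_left h, max_eq_left (pow_le_pow_left₀ (apply_nonneg _ _) h 2)]
  · have : ⇑(p.1 ⊔ q.1) = fun a => max (p.1 a) (q.1 a) := funext fun a => Seminorm.sup_apply ..
    rw [this]
    exact p.2.2.max q.2.2

instance : Nonempty (ContCStarSeminorm A) :=
  ⟨⟨0, ⟨fun a b => by simp, fun a => by simp⟩, continuous_const⟩⟩

/-- The continuous `C⋆`-seminorms are directed. -/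
theorem exists_ge_finset (s : Finset (ContCStarSeminorm A)) :
    ∃ r : ContCStarSeminorm A, ∀ p ∈ s, p.1 ≤ r.1 := by
  classical
  induction s using Finset.induction_on with
  | empty => exact ⟨Classical.arbitrary _, by simp⟩
  | insert p s _ ih =>
    obtain ⟨r, hr⟩ := ih
    obtain ⟨r', h1, h2⟩ := exists_ge_pair p r
    refine ⟨r', fun q hq => ?_⟩
    rcases Finset.mem_insert.1 hq with rfl | hq
    · exact h1
    · exact (hr q hq).trans h2

theorem star_conjugate_le (p : ContCStarSeminorm A) (a b : A) :
    p.1 (a * b * star a) ≤ p.1 a ^ 2 * p.1 b := by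
  have h1 := p.2.1.mul_le (a * b) (star a)
  have h2 := p.2.1.mul_le a b
  rw [p.2.1.star_eq] at h1
  nlinarith [apply_nonneg p.1 a]

end ContCStarSeminorm

/-! ### Topology of a module given by the seminorms `p̄`. -/

namespace PreHilbertModule
section
variable {𝒜 X Y : Type*} [Ring 𝒜] [StarRing 𝒜] [Algebra ℂ 𝒜] [UniformSpace 𝒜]
  [PartialOrder 𝒜] [StarOrderedRing 𝒜] [ProCStarAlgebra 𝒜]
  [AddCommGroup X] [Module ℂ X] [Module 𝒜 X] [IsScalarTower ℂ 𝒜 X] [PreHilbertModule 𝒜 X]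
  [AddCommGroup Y] [Module ℂ Y] [Module 𝒜 Y] [IsScalarTower ℂ 𝒜 Y] [PreHilbertModule 𝒜 Y]

theorem bar_le_bar {p q : ContCStarSeminorm 𝒜} (h : p.1 ≤ q.1) (ξ : X) :
    bar X p ξ ≤ bar X q ξ :=
  Real.sqrt_le_sqrt (h _)

theorem bar_le_mul_of_apply_le {p : ContCStarSeminorm 𝒜} {ξ : X} {η : Y} {c : ℝ} (hc : 0 ≤ c)
    (h : p.1 (inner 𝒜 ξ ξ) ≤ c ^ 2 * p.1 (inner 𝒜 η η)) : bar X p ξ ≤ c * bar Y p η := by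
  refine abs_le_of_sq_le_sq' ?_ (mul_nonneg hc (apply_nonneg _ _)) |>.2
  rwa [mul_pow, bar_sq, bar_sq]

theorem inner_zero_left (ξ : X) : inner 𝒜 (0 : X) ξ = 0 := by
  have := inner_sub_left (𝒜 := 𝒜) (0 : X) 0 ξ
  rwa [sub_self, sub_self] at this

theorem inner_sum_right {ι : Type*} (s : Finset ι) (ξ : X) (f : ι → X) :
    inner 𝒜 ξ (∑ i ∈ s, f i) = ∑ i ∈ s, inner 𝒜 ξ (f i) :=
  map_sum (AddMonoidHom.mk' (fun η => inner 𝒜 ξ η) (inner_add_right ξ)) f s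

variable [TopologicalSpace X]

/-- Basic neighbourhoods come from finite suprema of seminorms; directedness replaces each supremum
by one seminorm. This is what permits arguments for a single `p`. -/
theorem exists_bar_ball_subset
    (hX : WithSeminorms (fun p : ContCStarSeminorm 𝒜 => bar X p)) {e : Set X} (he : e ∈ 𝓝 0) :
    ∃ (p : ContCStarSeminorm 𝒜) (r : ℝ), 0 < r ∧ ∀ ξ : X, bar X p ξ < r → ξ ∈ e := by
  obtain ⟨⟨s, r⟩, hr, hsub⟩ := hX.hasBasis_zero_ball.mem_iff.1 he
  obtain ⟨p, hp⟩ := ContCStarSeminorm.exists_ge_finset s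
  refine ⟨p, r, hr, fun ξ hξ => hsub ?_⟩
  rw [Seminorm.mem_ball_zero]
  exact (Seminorm.finset_sup_apply_le (apply_nonneg _ _) fun q hq =>
    bar_le_bar (hp q hq) ξ).trans_lt hξ

theorem t1Space [IsTopologicalAddGroup X]
    (hX : WithSeminorms (fun p : ContCStarSeminorm 𝒜 => bar X p)) : T1Space X := by
  refine hX.T1_of_separating fun ξ hξ => ?_
  by_contra! h
  refine hξ ((inner_self (𝒜 := 𝒜) ξ).1 (ProCStarAlgebra.eq_zero_of_forall fun p => ?_))
  rw [← bar_sq, h p, zero_pow two_ne_zero]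

/-- Continuity of the inner product in the second variable, by Cauchy-Schwarz; it lets inner
products pass through infinite sums. -/
theorem tendsto_inner_right
    (hX : WithSeminorms (fun p : ContCStarSeminorm 𝒜 => bar X p)) (ξ : X) {ι : Type*}
    {l : Filter ι} {u : ι → X} {η : X} (hu : Tendsto u l (𝓝 η)) :
    Tendsto (fun i => inner 𝒜 ξ (u i)) l (𝓝 (inner 𝒜 ξ η)) := by
  refine ProCStarAlgebra.tendsto_of_forall fun p => ?_
  have h : Tendsto (fun i => bar X p (u i - η)) l (𝓝 0) := by
    rw [tendsto_order]
    exact ⟨fun a ha => Eventually.of_forall fun i => ha.trans_le (apply_nonneg _ _),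
      fun a ha => (hX.tendsto_nhds u η).1 hu p a ha⟩
  refine squeeze_zero (fun i => apply_nonneg _ _) (fun i => ?_)
    (by simpa using h.const_mul (bar X p ξ))
  rw [← inner_sub_right]
  exact apply_inner_le p _ _

end

/-! ### Closed range and surjectivity from two-sided bounds. -/

section
variable {𝒜 X Y : Type*} [Ring 𝒜] [StarRing 𝒜] [Algebra ℂ 𝒜] [UniformSpace 𝒜]
  [PartialOrder 𝒜] [StarOrderedRing 𝒜] [ProCStarAlgebra 𝒜]
  [AddCommGroup X] [Module ℂ X] [Module 𝒜 X] [IsScalarTower ℂ 𝒜 X] [PreHilbertModule 𝒜 X]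
  [AddCommGroup Y] [Module ℂ Y] [Module 𝒜 Y] [IsScalarTower ℂ 𝒜 Y] [PreHilbertModule 𝒜 Y]

/-- An operator which is bounded and bounded below for every seminorm has closed range. -/
theorem isClosed_range_of_bounded_below
    [UniformSpace X] [IsUniformAddGroup X] [CompleteSpace X]
    [UniformSpace Y] [IsUniformAddGroup Y]
    (hX : WithSeminorms (fun p : ContCStarSeminorm 𝒜 => bar X p))
    (hY : WithSeminorms (fun p : ContCStarSeminorm 𝒜 => bar Y p)) (D : X →ₗ[ℂ] Y)
    (hup : ∀ p : ContCStarSeminorm 𝒜, ∃ M : ℝ, ∀ ξ, bar Y p (D ξ) ≤ M * bar X p ξ)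
    (hlow : ∀ p : ContCStarSeminorm 𝒜, ∃ M : ℝ, ∀ ξ, bar X p ξ ≤ M * bar Y p (D ξ)) :
    IsClosed (Set.range D) := by
  have _ := t1Space hY
  -- The two bounds make the families `p̄_X` and `p̄_Y ∘ D` equivalent, so the topology of `X` is
  -- the one pulled back along `D`.
  have hind : IsInducing D := by
    have hcomp : WithSeminorms (SeminormFamily.comp (fun p : ContCStarSeminorm 𝒜 => bar Y p) D) := by
      refine hX.congr (Seminorm.IsBounded.of_real fun p => ?_)
        (Seminorm.IsBounded.of_real fun p => ?_)
      · obtain ⟨M, h⟩ := hup p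
        exact ⟨{p}, M, fun ξ => by simpa [SeminormFamily.comp_apply] using h ξ⟩
      · obtain ⟨M, h⟩ := hlow p
        exact ⟨{p}, M, fun ξ => by simpa [SeminormFamily.comp_apply] using h ξ⟩
    exact ⟨hcomp.withSeminorms_eq.trans
      (@WithSeminorms.withSeminorms_eq _ _ _ _ _ _ _ (_) (D.withSeminorms_induced hY)).symm⟩
  have hu : IsUniformInducing D := AddMonoidHom.isUniformInducing_of_isInducing hind
  -- Only `X` has to be complete: its image is then complete, hence closed in the Hausdorff space
  -- `Y`.
  exact (hu.isComplete_range).isClosed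

/-- Approximation up to a proportion of the size of the target implies dense range. -/
theorem exists_bar_sub_lt_of_contraction {p : ContCStarSeminorm 𝒜} (D : X →ₗ[ℂ] X) {k : ℝ}
    (hk0 : 0 ≤ k) (hk : k < 1) (h : ∀ η, ∃ ξ, bar X p (η - D ξ) ≤ k * bar X p η) (η : X) {ε : ℝ}
    (hε : 0 < ε) : ∃ ξ, bar X p (η - D ξ) < ε := by
  -- Successive correction: approximate the current residual and add the result, gaining a factor
  -- `k` each time.
  have hn : ∀ n : ℕ, ∃ ξ, bar X p (η - D ξ) ≤ k ^ n * bar X p η := by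
    intro n
    induction n with
    | zero => exact ⟨0, by simp⟩
    | succ n ih =>
      obtain ⟨ξ, hξ⟩ := ih
      obtain ⟨ζ, hζ⟩ := h (η - D ξ)
      refine ⟨ξ + ζ, ?_⟩
      rw [map_add, ← sub_sub, pow_succ', mul_assoc]
      exact hζ.trans (mul_le_mul_of_nonneg_left hξ hk0)
  have hlim : Tendsto (fun n : ℕ => k ^ n * bar X p η) atTop (𝓝 0) := by
    simpa using (tendsto_pow_atTop_nhds_zero_of_lt_one hk0 hk).mul_const (bar X p η)
  obtain ⟨n, hn'⟩ := (hlim.eventually (gt_mem_nhds hε)).exists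
  obtain ⟨ξ, hξ⟩ := hn n
  exact ⟨ξ, hξ.trans_lt hn'⟩

/-- A positive operator which is bounded and bounded below for `p` has `p`-dense range: the method
of continuity along `S + t`, `t ≥ 0`. -/
theorem exists_bar_sub_lt {p : ContCStarSeminorm 𝒜} (S : X →ₗ[ℂ] X)
    (hsym : ∀ ξ, inner 𝒜 ξ (S ξ) = inner 𝒜 (S ξ) ξ) (hpos : ∀ ξ, 0 ≤ inner 𝒜 (S ξ) ξ)
    {M c : ℝ} (hM : 0 < M) (hup : ∀ ξ, bar X p (S ξ) ≤ M * bar X p ξ)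
    (hc : 0 < c) (hlow : ∀ ξ, c * bar X p ξ ≤ bar X p (S ξ)) (η : X) {ε : ℝ} (hε : 0 < ε) :
    ∃ ξ, bar X p (η - S ξ) < ε := by
  -- The cross term `2t⟨Sξ, ξ⟩` and the term `t²⟨ξ, ξ⟩` are positive. Thus the lower bound `c` holds
  -- for every `S + t`, uniformly in `t`.
  have hmono : ∀ t : ℝ, 0 ≤ t → ∀ ξ, bar X p (S ξ) ≤ bar X p (S ξ + (t : ℂ) • ξ) := by
    intro t ht ξ
    refine Real.sqrt_le_sqrt (ProCStarAlgebra.mono p (inner_self_nonneg _) ?_)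
    have hstar : star (t : ℂ) = t := Complex.conj_ofReal t
    have e : inner 𝒜 (S ξ + (t : ℂ) • ξ) (S ξ + (t : ℂ) • ξ) = inner 𝒜 (S ξ) (S ξ)
        + (inner 𝒜 (S ((2 * t : ℂ) • ξ)) ξ + inner 𝒜 ((t : ℂ) • ξ) ((t : ℂ) • ξ)) := by
      simp only [inner_add_left, inner_add_right, map_smul, inner_smul_left_complex,
        inner_smul_right_complex, hstar, hsym]
      module
    rw [e]
    refine le_add_of_nonneg_right (add_nonneg ?_ (inner_self_nonneg _))
    -- Splitting `2t` as a square moves the scalar into both arguments, so that `hpos` applies at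
    -- `√(2t) ξ`.
    have e2 : inner 𝒜 (S ((2 * t : ℂ) • ξ)) ξ
        = inner 𝒜 (S (((√(2 * t) : ℝ) : ℂ) • ξ)) (((√(2 * t) : ℝ) : ℂ) • ξ) := by
      have hs : star ((√(2 * t) : ℝ) : ℂ) = (√(2 * t) : ℝ) := Complex.conj_ofReal _
      rw [map_smul, map_smul, inner_smul_left_complex, inner_smul_left_complex,
        inner_smul_right_complex, hs, smul_smul, ← Complex.ofReal_mul,
        Real.mul_self_sqrt (by positivity)]
      norm_num
    rw [e2]
    exact hpos _
  let D : ℝ → X →ₗ[ℂ] X := fun t => S + (t : ℂ) • LinearMap.id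
  have hD : ∀ t ξ, D t ξ = S ξ + (t : ℂ) • ξ := fun t ξ => rfl
  have hnorm : ∀ (t : ℝ), 0 ≤ t → ∀ ξ, bar X p ((t : ℂ) • ξ) = t * bar X p ξ := fun t ht ξ => by
    rw [map_smul_eq_mul, Complex.norm_real, Real.norm_of_nonneg ht]
  -- Starting point: at `t = 2M` the scalar part dominates, and `(2M)⁻¹ η` leaves the residual
  -- `-(2M)⁻¹ Sη`, at most half of `η`.
  have hlarge : ∀ (η : X) {ε : ℝ}, 0 < ε → ∃ ξ, bar X p (η - D (2 * M) ξ) < ε := by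
    intro η ε hε
    refine exists_bar_sub_lt_of_contraction (D (2 * M)) (k := 1 / 2) (by norm_num) (by norm_num)
      (fun η => ⟨(((2 * M)⁻¹ : ℝ) : ℂ) • η, ?_⟩) η hε
    have e : η - D (2 * M) ((((2 * M)⁻¹ : ℝ) : ℂ) • η) = -((((2 * M)⁻¹ : ℝ) : ℂ) • S η) := by
      rw [hD, map_smul, smul_smul, ← Complex.ofReal_mul, mul_inv_cancel₀ (by positivity),
        Complex.ofReal_one, one_smul]
      abel
    rw [e, map_neg_eq_map, hnorm _ (by positivity)]
    calc (2 * M)⁻¹ * bar X p (S η) ≤ (2 * M)⁻¹ * (M * bar X p η) := by gcongr; exact hup η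
      _ = 1 / 2 * bar X p η := by field_simp
  -- Solve for `t + s` with relative error `1/4`. Then `c p̄(ξ) ≤ (5/4) p̄(η)`, so dropping `s ξ`
  -- costs at most `5/16`; the total `9/16` is below the ratio `3/4`. The step length depends only
  -- on `c`.
  have hstep : ∀ t s : ℝ, 0 ≤ t → 0 ≤ s → s ≤ c / 4 →
      (∀ (η : X) {ε : ℝ}, 0 < ε → ∃ ξ, bar X p (η - D (t + s) ξ) < ε) →
      ∀ (η : X) {ε : ℝ}, 0 < ε → ∃ ξ, bar X p (η - D t ξ) < ε := by
    intro t s ht hs hsc h η ε hε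
    refine exists_bar_sub_lt_of_contraction (D t) (k := 3 / 4) (by norm_num) (by norm_num)
      (fun η => ?_) η hε
    rcases (apply_nonneg (bar X p) η).eq_or_lt with h0 | h0
    -- When `p̄(η) = 0` the relative tolerance is not positive, so this case is separate.
    · exact ⟨0, by rw [map_zero, sub_zero, ← h0, mul_zero]⟩
    obtain ⟨ξ, hξ⟩ := h η (ε := 1 / 4 * bar X p η) (by positivity)
    refine ⟨ξ, ?_⟩
    have e : η - D t ξ = (η - D (t + s) ξ) + (s : ℂ) • ξ := by
      rw [hD, hD, Complex.ofReal_add, add_smul]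
      abel
    have h1 : bar X p (η - D t ξ) ≤ bar X p (η - D (t + s) ξ) + s * bar X p ξ := by
      rw [e, ← hnorm s hs]
      exact map_add_le_add _ _ _
    have h2 : c * bar X p ξ ≤ bar X p (D (t + s) ξ) :=
      (hlow ξ).trans (hmono (t + s) (by positivity) ξ)
    have h3 : bar X p (D (t + s) ξ) ≤ bar X p η + bar X p (η - D (t + s) ξ) := by
      have := map_sub_le_add (bar X p) η (η - D (t + s) ξ)
      rwa [sub_sub_cancel] at this
    have h4 : s * bar X p ξ ≤ c / 4 * bar X p ξ := by gcongr
    linarith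
  -- Here `n` bounds the number of steps of length at most `c / 4` needed to descend from `2M` to
  -- `t`; the minimum below keeps a step from overshooting `2M`.
  have hall : ∀ n : ℕ, ∀ t : ℝ, 0 ≤ t → 2 * M ≤ t + n * (c / 4) → t ≤ 2 * M →
      ∀ (η : X) {ε : ℝ}, 0 < ε → ∃ ξ, bar X p (η - D t ξ) < ε := by
    intro n
    induction n with
    | zero =>
      intro t _ h1 h2
      obtain rfl : t = 2 * M := le_antisymm h2 (by simpa using h1)
      exact hlarge
    | succ n ih =>
      intro t ht h1 h2
      push_cast at h1
      refine hstep t (min (c / 4) (2 * M - t)) ht (le_min (by positivity) (by linarith))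
        (min_le_left _ _) (ih _ ?_ ?_ ?_)
      · exact add_nonneg ht (le_min (by positivity) (by linarith))
      · rcases min_choice (c / 4) (2 * M - t) with h | h <;> rw [h]
        · linarith
        · have : 0 ≤ (n : ℝ) * (c / 4) := by positivity
          linarith
      · linarith [min_le_right (c / 4) (2 * M - t)]
  obtain ⟨n, hn⟩ := exists_nat_ge (2 * M / (c / 4))
  obtain ⟨ξ, hξ⟩ := hall n 0 le_rfl (by
    rw [zero_add]; exact (div_le_iff₀ (by positivity)).1 hn) (by positivity) η hε
  refine ⟨ξ, ?_⟩
  rwa [hD, Complex.ofReal_zero, zero_smul, add_zero] at hξ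

/-- A positive operator which is bounded and bounded below for every seminorm is surjective. -/
theorem surjective_of_bounded_below [UniformSpace X] [HilbertModule 𝒜 X] (S : X →ₗ[ℂ] X)
    (hsym : ∀ ξ, inner 𝒜 ξ (S ξ) = inner 𝒜 (S ξ) ξ) (hpos : ∀ ξ, 0 ≤ inner 𝒜 (S ξ) ξ)
    (hup : ∀ p : ContCStarSeminorm 𝒜, ∃ M : ℝ, 0 < M ∧ ∀ ξ, bar X p (S ξ) ≤ M * bar X p ξ)
    (hlow : ∀ p : ContCStarSeminorm 𝒜, ∃ c : ℝ, 0 < c ∧ ∀ ξ, c * bar X p ξ ≤ bar X p (S ξ)) :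
    Function.Surjective S := by
  have _ : IsUniformAddGroup X := HilbertModule.toIsUniformAddGroup (𝒜 := 𝒜)
  have _ : CompleteSpace X := HilbertModule.toCompleteSpace (𝒜 := 𝒜)
  have hX := HilbertModule.withSeminorms (𝒜 := 𝒜) (X := X)
  have hcl : IsClosed (Set.range S) := by
    refine isClosed_range_of_bounded_below hX hX S
      (fun p => (hup p).imp fun M h => h.2) fun p => ?_
    obtain ⟨c, hc, h⟩ := hlow p
    refine ⟨c⁻¹, fun ξ => ?_⟩
    rw [inv_mul_eq_div, le_div_iff₀ hc, mul_comm]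
    exact h ξ
  refine Set.range_eq_univ.1 (hcl.closure_eq.symm.trans (Set.eq_univ_of_forall fun η => ?_))
  rw [mem_closure_iff_nhds]
  intro e he
  have he' : (fun ξ => η - ξ) ⁻¹' e ∈ 𝓝 (0 : X) := by
    refine (continuous_const.sub continuous_id).continuousAt.preimage_mem_nhds ?_
    simpa using he
  -- The neighbourhood selects one `p`, so the constants `M` and `c` may depend on it.
  obtain ⟨p, r, hr, hsub⟩ := exists_bar_ball_subset hX he'
  obtain ⟨M, hM, hM'⟩ := hup p
  obtain ⟨c, hc, hc'⟩ := hlow p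
  obtain ⟨ξ, hξ⟩ := exists_bar_sub_lt S hsym hpos hM hM' hc hc' η hr
  refine ⟨S ξ, ?_, ξ, rfl⟩
  simpa using hsub _ hξ

end
end PreHilbertModule


/-! ### The frame transform and its adjoint. -/

theorem StrictlyNonzero.isUnit {𝒜 : Type*} [Ring 𝒜] [Algebra ℂ 𝒜] {a : 𝒜}
    (h : StrictlyNonzero a) : IsUnit a :=
  (spectrum.zero_notMem_iff ℂ).1 h

namespace IsStarOperatorFrame
variable {𝒜 X I : Type*}
  [Ring 𝒜] [StarRing 𝒜] [Algebra ℂ 𝒜] [UniformSpace 𝒜] [PartialOrder 𝒜] [StarOrderedRing 𝒜]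
  [ProCStarAlgebra 𝒜]
  [AddCommGroup X] [Module ℂ X] [Module 𝒜 X] [IsScalarTower ℂ 𝒜 X] [PreHilbertModule 𝒜 X]
  {T : I → AdjointableOperator 𝒜 X X} {A B : 𝒜}

open PreHilbertModule

/-- The transform `ξ ↦ (T_i ξ)` of a frame, as a linear map. -/
def transform (hT : IsStarOperatorFrame T A B) : X →ₗ[𝒜] L2 𝒜 I X where
  toFun ξ := ⟨fun i => T i ξ, hT.summable ξ⟩
  map_add' ξ η := Subtype.ext (funext fun i => (T i).toLinearMap.map_add ξ η)
  map_smul' a ξ := Subtype.ext (funext fun i => (T i).toLinearMap.map_smul a ξ)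

theorem transform_apply (hT : IsStarOperatorFrame T A B) (ξ : X) (i : I) :
    (hT.transform ξ) i = T i ξ := rfl

theorem bar_transform_le (hT : IsStarOperatorFrame T A B) (p : ContCStarSeminorm 𝒜) (ξ : X) :
    bar (L2 𝒜 I X) p (hT.transform ξ) ≤ p.1 B * bar X p ξ :=
  bar_le_mul_of_apply_le (apply_nonneg _ _)
    ((ProCStarAlgebra.mono p (inner_self_nonneg _) (hT.upper ξ)).trans
      (ContCStarSeminorm.star_conjugate_le p _ _))

/-- Conjugating by `A⁻¹` recovers `⟨ξ, ξ⟩` from `A⟨ξ, ξ⟩A⋆`, which the lower frame bound controls.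
-/
theorem exists_bar_le_transform (hT : IsStarOperatorFrame T A B) (p : ContCStarSeminorm 𝒜) :
    ∃ M : ℝ, 0 < M ∧ ∀ ξ, bar X p ξ ≤ M * bar (L2 𝒜 I X) p (hT.transform ξ) := by
  obtain ⟨u, rfl⟩ := hT.lower_ne.isUnit
  set a : 𝒜 := ↑u⁻¹
  -- The `+ 1` secures a positive constant, since `p(A⁻¹)` vanishes when `p = 0`.
  refine ⟨p.1 a + 1, add_pos_of_nonneg_of_pos (apply_nonneg _ _) one_pos, fun ξ => ?_⟩
  have h : bar X p ξ ≤ p.1 a * bar (L2 𝒜 I X) p (hT.transform ξ) := by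
    refine bar_le_mul_of_apply_le (apply_nonneg _ _) ?_
    have e : inner 𝒜 ξ ξ = a * (u * inner 𝒜 ξ ξ * star (u : 𝒜)) * star a := by
      have h1 : a * u = 1 := u.inv_mul
      have h2 : star (u : 𝒜) * star a = 1 := by rw [← star_mul, h1, star_one]
      rw [← mul_assoc, ← mul_assoc, h1, one_mul, mul_assoc, h2, mul_one]
    have h3 : p.1 (u * inner 𝒜 ξ ξ * star (u : 𝒜))
        ≤ p.1 (inner 𝒜 (hT.transform ξ) (hT.transform ξ)) :=
      ProCStarAlgebra.mono p (star_right_conjugate_nonneg (inner_self_nonneg ξ) _) (hT.lower ξ)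
    calc p.1 (inner 𝒜 ξ ξ) = p.1 (a * (u * inner 𝒜 ξ ξ * star (u : 𝒜)) * star a) := by rw [← e]
      _ ≤ p.1 a ^ 2 * p.1 (u * inner 𝒜 ξ ξ * star (u : 𝒜)) :=
        ContCStarSeminorm.star_conjugate_le p _ _
      _ ≤ _ := by gcongr
  refine h.trans (mul_le_mul_of_nonneg_right ?_ (apply_nonneg _ _))
  linarith

theorem transform_injective (hT : IsStarOperatorFrame T A B) :
    Function.Injective hT.transform := by
  refine (injective_iff_map_eq_zero _).2 fun ξ hξ => ?_
  refine (inner_self (𝒜 := 𝒜) ξ).1 (ProCStarAlgebra.eq_zero_of_forall fun p => ?_)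
  obtain ⟨M, -, h⟩ := hT.exists_bar_le_transform p
  have h0 := h ξ
  rw [hξ, map_zero, mul_zero] at h0
  rw [← bar_sq, le_antisymm h0 (apply_nonneg _ _), zero_pow two_ne_zero]

/-- Finite partial sums of `∑ T_i⋆ x_i` are controlled by those of `∑ ⟨x_i, x_i⟩`. -/
theorem bar_sum_adjoint_le (hT : IsStarOperatorFrame T A B) (p : ContCStarSeminorm 𝒜)
    (s : Finset I) (x : I → X) :
    bar X p (∑ i ∈ s, (T i).adjoint (x i)) ≤ p.1 B * √(p.1 (∑ i ∈ s, inner 𝒜 (x i) (x i))) := by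
  classical
  set ζ := ∑ i ∈ s, (T i).adjoint (x i)
  have h0 : ∀ i ∉ s, inner 𝒜 (if i ∈ s then x i else 0) (if i ∈ s then x i else 0) = 0 :=
    fun i hi => by simp only [hi, if_false]; exact PreHilbertModule.inner_zero_left _
  let y : L2 𝒜 I X := ⟨fun i => if i ∈ s then x i else 0, summable_of_ne_finset_zero h0⟩
  have hy : ∀ i ∈ s, y i = x i := fun i hi => if_pos hi
  have hy' : ∀ i ∉ s, y i = 0 := fun i hi => if_neg hi
  have hyy : inner 𝒜 y y = ∑ i ∈ s, inner 𝒜 (x i) (x i) := by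
    rw [L2.inner_def, tsum_eq_sum h0]
    exact Finset.sum_congr rfl fun i hi => by simp only [hi, if_true]
  -- Testing `ζ` against itself moves each `T_i⋆` across, so the known bound on the transform
  -- controls the sum before its adjoint is available.
  have hζ : inner 𝒜 ζ ζ = inner 𝒜 (hT.transform ζ) y := by
    rw [L2.inner_def, tsum_eq_sum (s := s) fun i hi => by
      rw [hy' i hi, ← star_inner (𝒜 := 𝒜), PreHilbertModule.inner_zero_left, star_zero]]
    conv_lhs => rw [show inner 𝒜 ζ ζ = inner 𝒜 ζ (∑ i ∈ s, (T i).adjoint (x i)) from rfl]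
    rw [inner_sum_right]
    refine Finset.sum_congr rfl fun i hi => ?_
    rw [hy i hi, transform_apply, AdjointableOperator.inner_adjoint_right]
  have hb : bar (L2 𝒜 I X) p y = √(p.1 (∑ i ∈ s, inner 𝒜 (x i) (x i))) := by
    rw [bar_apply, hyy]
  rw [← hb]
  have h1 : bar X p ζ ^ 2 ≤ p.1 B * bar X p ζ * bar (L2 𝒜 I X) p y := by
    rw [bar_sq, hζ]
    exact (apply_inner_le p _ _).trans
      (mul_le_mul_of_nonneg_right (hT.bar_transform_le p ζ) (apply_nonneg _ _))
  rcases (apply_nonneg (bar X p) ζ).eq_or_lt with h | h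
  · rw [← h]; exact mul_nonneg (apply_nonneg _ _) (apply_nonneg _ _)
  · nlinarith

variable [UniformSpace X] [HilbertModule 𝒜 X]

/-- Cauchy criterion in the complete module `X`: blocks of the series are dominated by blocks of the
convergent series `∑ ⟨x_i, x_i⟩`. -/
theorem summable_adjoint (hT : IsStarOperatorFrame T A B) (x : L2 𝒜 I X) :
    Summable fun i => (T i).adjoint (x i) := by
  have _ : IsUniformAddGroup X := HilbertModule.toIsUniformAddGroup (𝒜 := 𝒜)
  have _ : CompleteSpace X := HilbertModule.toCompleteSpace (𝒜 := 𝒜)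
  rw [summable_iff_vanishing]
  intro e he
  obtain ⟨p, r, hr, hsub⟩ :=
    exists_bar_ball_subset (HilbertModule.withSeminorms (𝒜 := 𝒜) (X := X)) he
  have hB : 0 < p.1 B + 1 := add_pos_of_nonneg_of_pos (apply_nonneg _ _) one_pos
  have hmem : {a : 𝒜 | p.1 a < (r / (p.1 B + 1)) ^ 2} ∈ 𝓝 (0 : 𝒜) :=
    (isOpen_lt p.2.2 continuous_const).mem_nhds (by
      rw [Set.mem_ofPred_eq, map_zero]; positivity)
  obtain ⟨s, hs⟩ := summable_iff_vanishing.1 (L2.summable_inner_self x) _ hmem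
  refine ⟨s, fun t ht => hsub _ ((hT.bar_sum_adjoint_le p t x).trans_lt ?_)⟩
  have h1 : √(p.1 (∑ i ∈ t, inner 𝒜 (x i) (x i))) < r / (p.1 B + 1) :=
    (Real.sqrt_lt' (by positivity)).2 (hs t ht)
  rw [lt_div_iff₀ hB] at h1
  nlinarith [Real.sqrt_nonneg (p.1 (∑ i ∈ t, inner 𝒜 (x i) (x i)))]

theorem inner_transform_eq_of_hasSum (hT : IsStarOperatorFrame T A B) {x : L2 𝒜 I X} {η : X}
    (h : HasSum (fun i => (T i).adjoint (x i)) η) (ξ : X) :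
    inner 𝒜 (hT.transform ξ) x = inner 𝒜 ξ η := by
  rw [L2.inner_def]
  refine HasSum.tsum_eq ?_
  have h1 := tendsto_inner_right (HilbertModule.withSeminorms (𝒜 := 𝒜) (X := X)) ξ h
  refine h1.congr fun s => ?_
  rw [inner_sum_right]
  exact Finset.sum_congr rfl fun i _ => ((T i).inner_adjoint_right ξ (x i)).symm

/-- The transform of a frame, as an adjointable operator. -/
noncomputable def transformOperator (hT : IsStarOperatorFrame T A B) :
    AdjointableOperator 𝒜 X (L2 𝒜 I X) where
  toLinearMap := hT.transform
  exists_adjoint := ⟨fun x => ∑' i, (T i).adjoint (x i), fun ξ x =>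
    hT.inner_transform_eq_of_hasSum (hT.summable_adjoint x).hasSum ξ⟩
  bounded p := ⟨p.1 B + 1, add_pos_of_nonneg_of_pos (apply_nonneg _ _) one_pos, fun ξ =>
    (hT.bar_transform_le p ξ).trans
      (mul_le_mul_of_nonneg_right (by linarith) (apply_nonneg _ _))⟩

/-- The adjoint is a chosen witness, but its values are determined by inner products, which
identifies them with the sums. -/
theorem hasSum_adjoint (hT : IsStarOperatorFrame T A B) (x : L2 𝒜 I X) :
    HasSum (fun i => (T i).adjoint (x i)) (hT.transformOperator.adjoint x) := by
  obtain ⟨η, hη⟩ := hT.summable_adjoint x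
  have : hT.transformOperator.adjoint x = η := ext_inner (𝒜 := 𝒜) fun ξ =>
    (hT.transformOperator.inner_adjoint_right ξ x).symm.trans
      (hT.inner_transform_eq_of_hasSum hη ξ)
  rwa [this]

theorem seminorm_transformOperator_le (hT : IsStarOperatorFrame T A B)
    (p : ContCStarSeminorm 𝒜) : hT.transformOperator.seminorm p ≤ p.1 B := by
  refine Real.sSup_le ?_ (apply_nonneg _ _)
  rintro _ ⟨ξ, hξ, rfl⟩
  exact (hT.bar_transform_le p ξ).trans (mul_le_of_le_one_right (apply_nonneg _ _) hξ)

theorem isClosed_range_transform (hT : IsStarOperatorFrame T A B) :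
    IsClosed (Set.range hT.transform) := by
  have _ : IsUniformAddGroup X := HilbertModule.toIsUniformAddGroup (𝒜 := 𝒜)
  have _ : CompleteSpace X := HilbertModule.toCompleteSpace (𝒜 := 𝒜)
  exact isClosed_range_of_bounded_below (HilbertModule.withSeminorms (𝒜 := 𝒜)) L2.withSeminorms
    (hT.transform.restrictScalars ℂ) (fun p => ⟨p.1 B, hT.bar_transform_le p⟩)
    fun p => (hT.exists_bar_le_transform p).imp fun M h => h.2

theorem surjective_adjoint (hT : IsStarOperatorFrame T A B) :
    Function.Surjective hT.transformOperator.adjoint := by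
  set R := hT.transformOperator
  let S : X →ₗ[ℂ] X := (R.adjoint.toLinearMap.comp R.toLinearMap).restrictScalars ℂ
  have hS : ∀ ξ, S ξ = R.adjoint (R ξ) := fun ξ => rfl
  have h1 : ∀ ξ, inner 𝒜 ξ (S ξ) = inner 𝒜 (R ξ) (R ξ) := fun ξ => by
    rw [hS, R.inner_adjoint_right]
  have h2 : ∀ ξ, inner 𝒜 (S ξ) ξ = inner 𝒜 (R ξ) (R ξ) := fun ξ => by
    rw [← star_inner, h1, star_inner]
  have hsurj : Function.Surjective S := by
    refine surjective_of_bounded_below (𝒜 := 𝒜) S (fun ξ => (h1 ξ).trans (h2 ξ).symm)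
      (fun ξ => (h2 ξ).symm ▸ inner_self_nonneg _) (fun p => ?_) fun p => ?_
    · obtain ⟨M, hM, h⟩ := R.bounded p
      obtain ⟨N, hN, h'⟩ := R.adjoint.bounded p
      refine ⟨N * M, by positivity, fun ξ => (h' (R ξ)).trans ?_⟩
      rw [mul_assoc]
      exact mul_le_mul_of_nonneg_left (h ξ) hN.le
    · obtain ⟨M, hM, h⟩ := hT.exists_bar_le_transform p
      -- The constant comes from `p̄(ξ)² ≤ M² p̄(Rξ)² ≤ M² p̄(Sξ) p̄(ξ)`, by Cauchy-Schwarz and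
      -- `⟨Sξ, ξ⟩ = ⟨Rξ, Rξ⟩`, after cancelling `p̄(ξ)`.
      refine ⟨(M ^ 2)⁻¹, by positivity, fun ξ => ?_⟩
      rw [inv_mul_le_iff₀ (by positivity)]
      have h3 : bar (L2 𝒜 I X) p (R ξ) ^ 2 ≤ bar X p (S ξ) * bar X p ξ := by
        rw [bar_sq, ← h2]
        exact apply_inner_le p _ _
      have h4 : bar X p ξ ^ 2 ≤ M ^ 2 * bar (L2 𝒜 I X) p (R ξ) ^ 2 := by
        rw [← mul_pow]
        exact pow_le_pow_left₀ (apply_nonneg _ _) (h ξ) 2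
      have h5 : bar X p ξ ^ 2 ≤ M ^ 2 * (bar X p (S ξ) * bar X p ξ) :=
        h4.trans (mul_le_mul_of_nonneg_left h3 (by positivity))
      rcases (apply_nonneg (bar X p) ξ).eq_or_lt with h0 | h0
      · rw [← h0]; exact mul_nonneg (by positivity) (apply_nonneg _ _)
      · nlinarith
  exact fun η => (hsurj η).imp' R fun ξ h => h

end IsStarOperatorFrame

theorem theorem3p4 {𝒜 X I : Type*}
    [Ring 𝒜] [StarRing 𝒜] [Algebra ℂ 𝒜] [UniformSpace 𝒜] [PartialOrder 𝒜] [StarOrderedRing 𝒜]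
    [ProCStarAlgebra 𝒜]
    [AddCommGroup X] [Module ℂ X] [Module 𝒜 X] [IsScalarTower ℂ 𝒜 X] [PreHilbertModule 𝒜 X]
    [UniformSpace X] [HilbertModule 𝒜 X] [Countable I]
    (T : I → AdjointableOperator 𝒜 X X) (A B : 𝒜) (hT : IsStarOperatorFrame T A B) :
    ∃ R : AdjointableOperator 𝒜 X (L2 𝒜 I X),
      (∀ (ξ : X) (i : I), (R ξ) i = T i ξ) ∧
      Function.Injective R ∧
      IsClosed (Set.range R) ∧
      (∀ p : ContCStarSeminorm 𝒜, R.seminorm p ≤ p.1 B) ∧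
      (∀ x : L2 𝒜 I X, HasSum (fun i => (T i).adjoint (x i)) (R.adjoint x)) ∧
      Function.Surjective R.adjoint :=
  ⟨hT.transformOperator, hT.transform_apply, hT.transform_injective, hT.isClosed_range_transform,
    hT.seminorm_transformOperator_le, hT.hasSum_adjoint, hT.surjective_adjoint⟩
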